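/- Let $m,p\ge 0$ be integers, and write $C^\infty_n$ for the space of smooth functions $\mathbb{R}\to\mathbb{R}^n$. All matrices below are real polynomial matrices in one variable $s$ with a finite number of rows (possibly zero); $R(\tfrac{d}{dt})$ denotes the differential operator obtained from $R(s)$ by replacing $s$ by $\tfrac{d}{dt}$. Assumptions (and, likewise, an environment) are a system $\mathrm{A}:\ 0=A(\tfrac{d}{dt})u$, with input behaviour $\mathfrak{B}_i(\mathrm{A})=\{u\in C^\infty_m : 0=A(\tfrac{d}{dt})u\}$. Guarantees are a system $\Gamma:\ G(\tfrac{d}{dt})y=H(\tfrac{d}{dt})u$. Any system $S$ of this latter form has external behaviour $\mathfrak{B}(S)$, the set of $(u,y)\in C^\infty_m\times C^\infty_p$ that satisfy its equations, and input behaviour $\mathfrak{B}_i(S)=\{u\in C^\infty_m:\exists\, y\in C^\infty_p,\ (u,y)\in\mathfrak{B}(S)\}$. The interconnection $\mathrm{E}\wedge S$ of $\mathrm{E}:\ 0=E(\tfrac{d}{dt})u$ with $S:\ G(\tfrac{d}{dt})y=H(\tfrac{d}{dt})u$ is the system $$\begin{bmatrix}G(\tfrac{d}{dt})\\0\end{bmatrix}y=\begin{bmatrix}H(\tfrac{d}{dt})\\E(\tfrac{d}{dt})\end{bmatrix}u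 .$$ A contract is a pair $\mathcal{C}=(\mathrm{A},\Gamma)$. An implementation of $\mathcal{C}$ is a system $\Sigma:\ P(\tfrac{d}{dt})y=Q(\tfrac{d}{dt})u$ in input-output form, i.e. with $P(s)$ square and invertible as a rational matrix and $P(s)^{-1}Q(s)$ proper (in every entry the degree of the numerator is at most that of the denominator), such that $\mathfrak{B}(\mathrm{E}\wedge\Sigma)\subseteq\mathfrak{B}(\Gamma)$ for all environments $\mathrm{E}$ with $\mathfrak{B}_i(\mathrm{E})\subseteq\mathfrak{B}_i(\mathrm{A})$. The contract is consistent if it has at least one implementation. **Lemma.** Let $\mathcal{C}=(\mathrm{A},\Gamma)$ be a contract. 1. If $\mathcal{C}$ is consistent, then $\mathfrak{B}_i(\mathrm{A})\subseteq\mathfrak{B}_i(\Gamma)$. 2. If $\mathfrak{B}_i(\mathrm{A})\subseteq\mathfrak{B}_i(\Gamma)$ (in particular, if $\mathcal{C}$ is consistent), then there exist guarantees $\Gamma':\ G'(\tfrac{d}{dt})y=H'(\tfrac{d}{dt})u$ such that $G'(s)$ has full row rank (over the field of rational functions; a matrix without rows has full row rank) and $\mathfrak{B}(\mathrm{A}\wedge\Gamma)=\mathfrak{B}(\mathrm{A}\wedge\Gamma')$.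 -/

import Mathlib

open Polynomial
open scoped ContDiff

noncomputable section

namespace LTI

/-- The space of smooth trajectories `ℝ → ℝⁿ`. -/
def SmoothTraj (n : ℕ) : Set (ℝ → Fin n → ℝ) := {w | ContDiff ℝ ∞ w}

/-- The differential operator `p(d/dt)` applied to a scalar function: for `p(s) = ∑ aₖ sᵏ`
this is `∑ aₖ f⁽ᵏ⁾`. -/
def diffOp (p : ℝ[X]) (f : ℝ → ℝ) : ℝ → ℝ :=
  fun t => p.sum fun k a => a * iteratedDeriv k f t

/-- The matrix differential operator `R(d/dt)` applied to a vector-valued function. -/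
def matDiffOp {q n : ℕ} (R : Matrix (Fin q) (Fin n) ℝ[X]) (w : ℝ → Fin n → ℝ) :
    ℝ → Fin q → ℝ :=
  fun t i => ∑ j, diffOp (R i j) (fun τ => w τ j) t

/-- A polynomial matrix regarded as a rational matrix. -/
def toRational {q n : ℕ} (R : Matrix (Fin q) (Fin n) ℝ[X]) :
    Matrix (Fin q) (Fin n) (RatFunc ℝ) :=
  R.map (algebraMap ℝ[X] (RatFunc ℝ))

/-- Full row rank: the rank, over the field of rational functions, is the number of rows. -/
def FullRowRank {q n : ℕ} (R : Matrix (Fin q) (Fin n) ℝ[X]) : Prop :=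
  (toRational R).rank = q

/-- A square polynomial matrix is invertible if it has a rational inverse. -/
def IsInvertible {n : ℕ} (P : Matrix (Fin n) (Fin n) ℝ[X]) : Prop :=
  ∃ R : Matrix (Fin n) (Fin n) (RatFunc ℝ), toRational P * R = 1

/-- A rational function is proper if the degree of its numerator is at most that of its
denominator. -/
def IsProperRat (f : RatFunc ℝ) : Prop := f.num.degree ≤ f.denom.degree

/-- `P(d/dt) y = Q(d/dt) u` is in input-output form: `P` is invertible and `P⁻¹ Q` is proper. -/
def IsInputOutputForm {m p : ℕ} (P : Matrix (Fin p) (Fin p) ℝ[X])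
    (Q : Matrix (Fin p) (Fin m) ℝ[X]) : Prop :=
  IsInvertible P ∧ ∀ i j, IsProperRat (((toRational P)⁻¹ * toRational Q) i j)

/-- A system `0 = E(d/dt) u` in the input `u` only (an environment, or assumptions), with any
finite number of equations. -/
structure InputSystem (m : ℕ) where
  rows : ℕ
  E : Matrix (Fin rows) (Fin m) ℝ[X]

/-- The input behaviour of `0 = E(d/dt) u`. -/
def InputSystem.inputBehaviour {m : ℕ} (A : InputSystem m) : Set (ℝ → Fin m → ℝ) :=
  {u | u ∈ SmoothTraj m ∧ 0 = matDiffOp A.E u}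

/-- A system `G(d/dt) y = H(d/dt) u` with input `u` and output `y`, with any finite number of
equations. -/
structure System (m p : ℕ) where
  rows : ℕ
  G : Matrix (Fin rows) (Fin p) ℝ[X]
  H : Matrix (Fin rows) (Fin m) ℝ[X]

/-- The external behaviour of `G(d/dt) y = H(d/dt) u`, a set of pairs `(u, y)`. -/
def System.behaviour {m p : ℕ} (S : System m p) :
    Set ((ℝ → Fin m → ℝ) × (ℝ → Fin p → ℝ)) :=
  {w | w.1 ∈ SmoothTraj m ∧ w.2 ∈ SmoothTraj p ∧ matDiffOp S.G w.2 = matDiffOp S.H w.1}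

/-- The input behaviour: the projection of the external behaviour onto `u`. -/
def System.inputBehaviour {m p : ℕ} (S : System m p) : Set (ℝ → Fin m → ℝ) :=
  {u | ∃ y, (u, y) ∈ S.behaviour}

/-- The interconnection `E ∧ S`, given by the stacked equations
`[G; 0](d/dt) y = [H; E](d/dt) u`. -/
def interconnect {m p : ℕ} (E : InputSystem m) (S : System m p) : System m p where
  rows := S.rows + E.rows
  G := (Matrix.fromRows S.G (0 : Matrix (Fin E.rows) (Fin p) ℝ[X])).submatrix
    finSumFinEquiv.symm id
  H := (Matrix.fromRows S.H E.E).submatrix finSumFinEquiv.symm id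

/-- A contract is a pair of assumptions and guarantees. -/
structure Contract (m p : ℕ) where
  assumptions : InputSystem m
  guarantees : System m p

namespace Contract

variable {m p : ℕ}

/-- An environment is compatible with `C` if its input behaviour is contained in that of the
assumptions. -/
def Compatible (C : Contract m p) (E : InputSystem m) : Prop :=
  E.inputBehaviour ⊆ C.assumptions.inputBehaviour

/-- The system `P(d/dt) y = Q(d/dt) u` implements `C`: it is in input-output form and its
interconnection with every compatible environment satisfies the guarantees. -/
def Implements (C : Contract m p) (P : Matrix (Fin p) (Fin p) ℝ[X])
    (Q : Matrix (Fin p) (Fin m) ℝ[X]) : Prop :=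
  IsInputOutputForm P Q ∧
    ∀ E : InputSystem m, C.Compatible E →
      (interconnect E (System.mk p P Q)).behaviour ⊆ C.guarantees.behaviour

/-- A contract is consistent if it has at least one implementation. -/
def Consistent (C : Contract m p) : Prop :=
  ∃ (P : Matrix (Fin p) (Fin p) ℝ[X]) (Q : Matrix (Fin p) (Fin m) ℝ[X]), C.Implements P Q

end Contract

end LTI

end

/-!
Smooth functions form a module over `ℝ[X]`, with `X` acting as `d/dt`, and the operator `R(d/dt)` is
the action of the matrix `R` on vectors with entries in this module. Two algebraic facts about this
action give the theorem.

* If `det P ≠ 0`, then `P(d/dt)` is surjective (`LTI.exists_polyAct_eq`). Because of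
  `P * adj P = det P • 1`, this reduces to a scalar equation `p(d/dt) z = f` with `p ≠ 0`
  (`LTI.aeval_differentiation_surjective_real`), which is solved over `ℂ`, where `p` is a product of
  linear factors and each first-order equation has an explicit solution, and then by taking the
  real part. Hence an implementation `P y = Q u` of the contract has an output `y` for every
  admissible input `u`; with the assumptions themselves as environment, `(u, y)` is in the behaviour
  of the guarantees.
* As `ℝ[X]` is a principal ideal domain, the row module of `G` is free, so a basis of it gives
  a matrix `G'` of full row rank with `G' = B * G` and `G = C * G'`
  (`LTI.exists_fullRowRank_factorization`). Put `H' = B * H`. Clearly `G y = H u` implies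
  `G' y = H' u`. Conversely, if `G' y = H' u` and `u` is an input of the guarantees, say
  `G y₀ = H u`, then `G y = C B H u = C B G y₀ = G y₀ = H u`.
-/

open Polynomial
open scoped ContDiff

noncomputable section

namespace LTI

/-! ### Smooth functions as a module over differential operators -/

/-- The smooth functions `ℝ → 𝕜` of a real variable, as a `𝕜`-linear space. -/
def smoothFun (𝕜 : Type*) [RCLike 𝕜] : Submodule 𝕜 (ℝ → 𝕜) where
  carrier := {f | ContDiff ℝ ∞ f}
  add_mem' {f g} (hf : ContDiff ℝ ∞ f) (hg : ContDiff ℝ ∞ g) := hf.add hg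
  zero_mem' := (contDiff_const : ContDiff ℝ ∞ fun _ => (0 : 𝕜))
  smul_mem' c f (hf : ContDiff ℝ ∞ f) := hf.const_smul c

lemma contDiff_smoothFun {𝕜 : Type*} [RCLike 𝕜] (f : smoothFun 𝕜) : ContDiff ℝ ∞ f.1 := f.2

/-- Differentiation `d/dt` as an endomorphism of the space of smooth functions. -/
def differentiation (𝕜 : Type*) [RCLike 𝕜] : Module.End 𝕜 (smoothFun 𝕜) where
  toFun f := ⟨deriv f.1, (contDiff_infty_iff_deriv.1 (contDiff_smoothFun f)).2⟩
  map_add' f g := by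
    ext t
    exact deriv_add ((contDiff_infty_iff_deriv.1 (contDiff_smoothFun f)).1 t)
      ((contDiff_infty_iff_deriv.1 (contDiff_smoothFun g)).1 t)
  map_smul' c f := by
    ext t
    exact deriv_const_smul c ((contDiff_infty_iff_deriv.1 (contDiff_smoothFun f)).1 t)

lemma differentiation_pow_apply {𝕜 : Type*} [RCLike 𝕜] (k : ℕ) (f : smoothFun 𝕜) :
    ((differentiation 𝕜 ^ k) f).1 = iteratedDeriv k f.1 := by
  induction k with
  | zero => simp
  | succ k ih =>
    rw [pow_succ', iteratedDeriv_succ, ← ih]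
    rfl

lemma diffOp_eq_aeval (p : ℝ[X]) (f : smoothFun ℝ) :
    diffOp p f.1 = (aeval (differentiation ℝ) p f).1 := by
  funext t
  rw [aeval_eq_sum_range, diffOp, sum_over_range _ (by simp), LinearMap.sum_apply,
    AddSubmonoidClass.coe_finsetSum, Finset.sum_apply]
  exact Finset.sum_congr rfl fun k _ => by
    rw [← differentiation_pow_apply]
    rfl

/-! ### Scalar linear differential equations with constant coefficients -/

/-- The equation `z' - c z = f` is solved by `z t = exp (c t) * ∫₀ᵗ exp (-c τ) f τ dτ`. -/
lemma differentiation_sub_algebraMap_surjective (c : ℂ) :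
    Function.Surjective (differentiation ℂ - algebraMap ℂ (Module.End ℂ (smoothFun ℂ)) c) := by
  intro f
  have hexp (a : ℂ) (t : ℝ) :
      HasDerivAt (fun t : ℝ => Complex.exp (a * t)) (Complex.exp (a * t) * a) t := by
    simpa using ((Complex.ofRealCLM.hasDerivAt (x := t)).const_mul a).cexp
  have hexp_smooth (a : ℂ) : ContDiff ℝ ∞ (fun t : ℝ => Complex.exp (a * t)) :=
    (contDiff_const.mul Complex.ofRealCLM.contDiff).cexp
  have hg : ContDiff ℝ ∞ (fun t : ℝ => Complex.exp (-c * t) * f.1 t) :=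
    (hexp_smooth _).mul (contDiff_smoothFun f)
  have hI (t : ℝ) : HasDerivAt (fun t : ℝ => ∫ τ in (0 : ℝ)..t, Complex.exp (-c * τ) * f.1 τ)
      (Complex.exp (-c * t) * f.1 t) t :=
    (hg.continuous.integral_hasStrictDerivAt 0 t).hasDerivAt
  have hI_smooth : ContDiff ℝ ∞
      (fun t : ℝ => ∫ τ in (0 : ℝ)..t, Complex.exp (-c * τ) * f.1 τ) := by
    rw [contDiff_infty_iff_deriv]
    exact ⟨fun t => (hI t).differentiableAt, by rwa [funext fun t => (hI t).deriv]⟩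
  refine ⟨⟨_, (hexp_smooth c).mul hI_smooth⟩, ?_⟩
  ext t
  change deriv (fun t : ℝ => Complex.exp (c * t) * ∫ τ in (0 : ℝ)..t, Complex.exp (-c * τ) * f.1 τ)
    t - c * (Complex.exp (c * t) * ∫ τ in (0 : ℝ)..t, Complex.exp (-c * τ) * f.1 τ) = f.1 t
  rw [((hexp c t).fun_mul (hI t)).deriv]
  have hcancel : Complex.exp (c * t) * Complex.exp (-c * t) = 1 := by
    rw [← Complex.exp_add]
    simp
  linear_combination f.1 t * hcancel

lemma aeval_differentiation_surjective_complex {p : ℂ[X]} (hp : p ≠ 0) :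
    Function.Surjective (aeval (differentiation ℂ) p) := by
  have hprod (s : Multiset ℂ) :
      Function.Surjective (aeval (differentiation ℂ) (s.map fun a => X - C a).prod) := by
    induction s using Multiset.induction_on with
    | empty =>
      rw [Multiset.map_zero, Multiset.prod_zero, map_one]
      exact Function.surjective_id
    | cons a s ih =>
      rw [Multiset.map_cons, Multiset.prod_cons, map_mul, Module.End.mul_eq_comp,
        LinearMap.coe_comp]
      refine Function.Surjective.comp ?_ ih
      simpa using differentiation_sub_algebraMap_surjective a
  intro f
  obtain ⟨z, hz⟩ := hprod p.roots (p.leadingCoeff⁻¹ • f)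
  refine ⟨z, ?_⟩
  rw [(IsAlgClosed.splits p).eq_prod_roots, map_mul, Module.End.mul_apply, hz, aeval_C,
    Module.algebraMap_end_apply, smul_smul, mul_inv_cancel₀ (leadingCoeff_ne_zero.2 hp), one_smul]

/-- The real part of a smooth complex-valued function. -/
def rePart : smoothFun ℂ →ₗ[ℝ] smoothFun ℝ where
  toFun z := ⟨fun t => (z.1 t).re, Complex.reCLM.contDiff.comp (contDiff_smoothFun z)⟩
  map_add' _ _ := rfl
  map_smul' c z := by
    ext t
    exact Complex.re_ofReal_mul c (z.1 t)

lemma rePart_differentiation (z : smoothFun ℂ) :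
    rePart (differentiation ℂ z) = differentiation ℝ (rePart z) := by
  ext t
  have hz := ((contDiff_infty_iff_deriv.1 (contDiff_smoothFun z)).1 t).hasDerivAt
  exact ((Complex.reCLM.hasFDerivAt.comp_hasDerivAt t hz).deriv).symm

/-- A differential operator with real coefficients commutes with taking the real part. -/
lemma rePart_aeval_map (p : ℝ[X]) (z : smoothFun ℂ) :
    rePart (aeval (differentiation ℂ) (p.map (algebraMap ℝ ℂ)) z) =
      aeval (differentiation ℝ) p (rePart z) := by
  induction p using Polynomial.induction_on generalizing z with
  | C a =>
    rw [Polynomial.map_C, aeval_C, aeval_C, Module.algebraMap_end_apply,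
      Module.algebraMap_end_apply, ← map_smul]
    rfl
  | add p q hp hq => simp only [Polynomial.map_add, map_add, LinearMap.add_apply, hp, hq]
  | monomial n a ih =>
    simp only [pow_succ, ← mul_assoc, Polynomial.map_mul (p := C a * X ^ n), Polynomial.map_X,
      map_mul (aeval _) _ X, aeval_X, Module.End.mul_apply, ih, rePart_differentiation]

lemma aeval_differentiation_surjective_real {p : ℝ[X]} (hp : p ≠ 0) :
    Function.Surjective (aeval (differentiation ℝ) p) := by
  intro f
  have hp' : p.map (algebraMap ℝ ℂ) ≠ 0 :=
    (Polynomial.map_ne_zero_iff (algebraMap ℝ ℂ).injective).2 hp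
  obtain ⟨z, hz⟩ := aeval_differentiation_surjective_complex hp'
    ⟨fun t => (f.1 t : ℂ), Complex.ofRealCLM.contDiff.comp (contDiff_smoothFun f)⟩
  refine ⟨rePart z, ?_⟩
  rw [← rePart_aeval_map, hz]
  rfl

/-! ### Matrix differential operators -/

/-- The action of a polynomial matrix on vectors of smooth functions. -/
def polyAct {q n : ℕ} (R : Matrix (Fin q) (Fin n) ℝ[X]) (w : Fin n → smoothFun ℝ) :
    Fin q → smoothFun ℝ :=
  fun i => ∑ j, aeval (differentiation ℝ) (R i j) (w j)

lemma polyAct_mul {q r n : ℕ} (R : Matrix (Fin q) (Fin r) ℝ[X]) (S : Matrix (Fin r) (Fin n) ℝ[X])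
    (w : Fin n → smoothFun ℝ) : polyAct (R * S) w = polyAct R (polyAct S w) := by
  funext i
  simp only [polyAct, Matrix.mul_apply, map_sum, map_mul, LinearMap.sum_apply,
    Module.End.mul_apply]
  exact Finset.sum_comm

lemma polyAct_smul_one {n : ℕ} (d : ℝ[X]) (w : Fin n → smoothFun ℝ) (i : Fin n) :
    polyAct (d • (1 : Matrix (Fin n) (Fin n) ℝ[X])) w i = aeval (differentiation ℝ) d (w i) := by
  rw [polyAct, Finset.sum_eq_single i]
  · simp
  · intro j _ hji
    simp [Matrix.one_apply_ne hji.symm]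
  · simp

/-- The components of a smooth trajectory. -/
def components {n : ℕ} {w : ℝ → Fin n → ℝ} (hw : w ∈ SmoothTraj n) : Fin n → smoothFun ℝ :=
  fun j => ⟨fun t => w t j, contDiff_pi.1 (show ContDiff ℝ ∞ w from hw) j⟩

/-- The trajectory with given smooth components. -/
def trajectory {n : ℕ} (w : Fin n → smoothFun ℝ) : ℝ → Fin n → ℝ := fun t j => (w j).1 t

lemma trajectory_mem_smoothTraj {n : ℕ} (w : Fin n → smoothFun ℝ) :
    trajectory w ∈ SmoothTraj n :=
  show ContDiff ℝ ∞ (trajectory w) from contDiff_pi.2 fun j => contDiff_smoothFun (w j)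

lemma matDiffOp_trajectory {q n : ℕ} (R : Matrix (Fin q) (Fin n) ℝ[X])
    (w : Fin n → smoothFun ℝ) : matDiffOp R (trajectory w) = trajectory (polyAct R w) := by
  funext t i
  simp only [matDiffOp, trajectory, polyAct, AddSubmonoidClass.coe_finsetSum, Finset.sum_apply]
  exact Finset.sum_congr rfl fun j _ => congrFun (diffOp_eq_aeval (R i j) (w j)) t

lemma matDiffOp_mem_smoothTraj {q n : ℕ} (R : Matrix (Fin q) (Fin n) ℝ[X]) {w : ℝ → Fin n → ℝ}
    (hw : w ∈ SmoothTraj n) : matDiffOp R w ∈ SmoothTraj q := by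
  have h := matDiffOp_trajectory R (components hw)
  exact h ▸ trajectory_mem_smoothTraj _

lemma matDiffOp_mul {q r n : ℕ} (R : Matrix (Fin q) (Fin r) ℝ[X])
    (S : Matrix (Fin r) (Fin n) ℝ[X]) {w : ℝ → Fin n → ℝ} (hw : w ∈ SmoothTraj n) :
    matDiffOp (R * S) w = matDiffOp R (matDiffOp S w) := by
  change matDiffOp _ (trajectory (components hw)) =
    matDiffOp R (matDiffOp S (trajectory (components hw)))
  rw [matDiffOp_trajectory, matDiffOp_trajectory, matDiffOp_trajectory, polyAct_mul]

lemma exists_polyAct_eq {n : ℕ} {P : Matrix (Fin n) (Fin n) ℝ[X]} (hP : P.det ≠ 0)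
    (f : Fin n → smoothFun ℝ) : ∃ y, polyAct P y = f := by
  choose z hz using fun i => aeval_differentiation_surjective_real hP (f i)
  refine ⟨polyAct P.adjugate z, ?_⟩
  rw [← polyAct_mul, Matrix.mul_adjugate]
  funext i
  rw [polyAct_smul_one, hz]

lemma IsInvertible.det_ne_zero {n : ℕ} {P : Matrix (Fin n) (Fin n) ℝ[X]} (hP : IsInvertible P) :
    P.det ≠ 0 := by
  obtain ⟨R, hR⟩ := hP
  intro h0
  have hdet : (toRational P).det = algebraMap ℝ[X] (RatFunc ℝ) P.det :=
    (RingHom.map_det _ P).symm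
  have h1 := congrArg Matrix.det hR
  rw [Matrix.det_mul, hdet, h0, map_zero, zero_mul, Matrix.det_one] at h1
  exact zero_ne_one h1

lemma IsInvertible.exists_matDiffOp_eq {n : ℕ} {P : Matrix (Fin n) (Fin n) ℝ[X]}
    (hP : IsInvertible P) {f : ℝ → Fin n → ℝ} (hf : f ∈ SmoothTraj n) :
    ∃ y ∈ SmoothTraj n, matDiffOp P y = f := by
  obtain ⟨y, hy⟩ := exists_polyAct_eq hP.det_ne_zero (components hf)
  refine ⟨trajectory y, trajectory_mem_smoothTraj y, ?_⟩
  rw [matDiffOp_trajectory, hy]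
  rfl

/-! ### Reduction to full row rank -/

lemma fullRowRank_of_linearIndependent {r p : ℕ} {G : Matrix (Fin r) (Fin p) ℝ[X]}
    (h : LinearIndependent ℝ[X] G.row) : FullRowRank G := by
  let φ : (Fin p → ℝ[X]) →ₗ[ℝ[X]] (Fin p → RatFunc ℝ) :=
    (Algebra.linearMap ℝ[X] (RatFunc ℝ)).compLeft (Fin p)
  have hφ : Function.Injective φ := fun v w hvw =>
    funext fun j => IsFractionRing.injective ℝ[X] (RatFunc ℝ) (congrFun hvw j)
  have hpoly : LinearIndependent ℝ[X] (toRational G).row := h.map' φ (LinearMap.ker_eq_bot.2 hφ)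
  rw [LinearIndependent.iff_fractionRing ℝ[X] (RatFunc ℝ)] at hpoly
  exact hpoly.rank_matrix.trans (Fintype.card_fin r)

/-- The rows of `G'` are a basis of the row module of `G`, a submodule of a free module over a
principal ideal domain. -/
lemma exists_fullRowRank_factorization {q p : ℕ} (G : Matrix (Fin q) (Fin p) ℝ[X]) :
    ∃ (r : ℕ) (G' : Matrix (Fin r) (Fin p) ℝ[X]) (B : Matrix (Fin r) (Fin q) ℝ[X])
      (C : Matrix (Fin q) (Fin r) ℝ[X]), FullRowRank G' ∧ G' = B * G ∧ G = C * G' := by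
  obtain ⟨r, ⟨b⟩⟩ : ∃ r : ℕ,
      Nonempty (Module.Basis (Fin r) ℝ[X] (Submodule.span ℝ[X] (Set.range G.row))) :=
    ⟨_, ⟨(Submodule.basisOfPid (Pi.basisFun ℝ[X] (Fin p)) _).2⟩⟩
  have hli : LinearIndependent ℝ[X] (Matrix.of fun i => (b i : Fin p → ℝ[X])).row :=
    b.linearIndependent.map' (Submodule.span ℝ[X] (Set.range G.row)).subtype
      (Submodule.ker_subtype _)
  have hB (i : Fin r) : ∃ c : Fin q → ℝ[X], ∑ k, c k • G.row k = (b i : Fin p → ℝ[X]) :=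
    Submodule.mem_span_range_iff_exists_fun ℝ[X] |>.1 (b i).2
  choose B hB using hB
  have hmem (k : Fin q) : G.row k ∈ Submodule.span ℝ[X] (Set.range G.row) :=
    Submodule.subset_span ⟨k, rfl⟩
  refine ⟨r, Matrix.of fun i => b i, Matrix.of B, Matrix.of fun k i => b.repr ⟨_, hmem k⟩ i,
    fullRowRank_of_linearIndependent hli, ?_, ?_⟩
  · ext1 i j
    simp [← hB i, Matrix.mul_apply]
  · ext1 k j
    have h := congrArg (fun v : Submodule.span ℝ[X] (Set.range G.row) => (v : Fin p → ℝ[X]) j)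
      (b.sum_repr ⟨_, hmem k⟩)
    simp only [AddSubmonoidClass.coe_finsetSum, Finset.sum_apply] at h
    exact h.symm

/-! ### Behaviours of interconnections -/

lemma mem_behaviour_interconnect_iff {m p : ℕ} (E : InputSystem m) (S : System m p)
    (w : (ℝ → Fin m → ℝ) × (ℝ → Fin p → ℝ)) :
    w ∈ (interconnect E S).behaviour ↔ w ∈ S.behaviour ∧ w.1 ∈ E.inputBehaviour := by
  have hG (t : ℝ) (i : Fin S.rows ⊕ Fin E.rows) :
      matDiffOp (interconnect E S).G w.2 t (finSumFinEquiv i) =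
        Sum.elim (matDiffOp S.G w.2 t) 0 i := by
    cases i <;> simp [matDiffOp, interconnect, diffOp]
  have hH (t : ℝ) (i : Fin S.rows ⊕ Fin E.rows) :
      matDiffOp (interconnect E S).H w.1 t (finSumFinEquiv i) =
        Sum.elim (matDiffOp S.H w.1 t) (matDiffOp E.E w.1 t) i := by
    cases i <;> simp [matDiffOp, interconnect]
  have key : matDiffOp (interconnect E S).G w.2 = matDiffOp (interconnect E S).H w.1 ↔
      matDiffOp S.G w.2 = matDiffOp S.H w.1 ∧ 0 = matDiffOp E.E w.1 := by
    simp only [funext_iff]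
    constructor
    · intro h
      exact ⟨fun t i => by
          have hi := h t (finSumFinEquiv (Sum.inl i))
          rwa [hG, hH] at hi,
        fun t i => by
          have hi := h t (finSumFinEquiv (Sum.inr i))
          rwa [hG, hH] at hi⟩
    · rintro ⟨h₁, h₂⟩ t i
      obtain ⟨i, rfl⟩ := finSumFinEquiv.surjective i
      rw [hG, hH]
      cases i with
      | inl i => exact h₁ t i
      | inr i => exact h₂ t i
  simp only [System.behaviour, InputSystem.inputBehaviour, Set.mem_ofPred_eq, key]
  tauto

lemma Contract.Consistent.inputBehaviour_subset {m p : ℕ} {C : Contract m p}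
    (hC : C.Consistent) : C.assumptions.inputBehaviour ⊆ C.guarantees.inputBehaviour := by
  obtain ⟨P, Q, ⟨hP, -⟩, hPQ⟩ := hC
  intro u hu
  obtain ⟨y, hy, hyu⟩ := hP.exists_matDiffOp_eq (matDiffOp_mem_smoothTraj Q hu.1)
  exact ⟨y, hPQ C.assumptions subset_rfl
    ((mem_behaviour_interconnect_iff _ _ _).2 ⟨⟨hu.1, hy, hyu⟩, hu⟩)⟩

lemma exists_fullRowRank_interconnect_eq {m p : ℕ} {A : InputSystem m} {Γ : System m p}
    (h : A.inputBehaviour ⊆ Γ.inputBehaviour) :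
    ∃ Γ' : System m p, FullRowRank Γ'.G ∧
      (interconnect A Γ).behaviour = (interconnect A Γ').behaviour := by
  obtain ⟨r, G', B, C, hrank, hB, hC⟩ := exists_fullRowRank_factorization Γ.G
  refine ⟨⟨r, G', B * Γ.H⟩, hrank, ?_⟩
  ext ⟨u, y⟩
  rw [mem_behaviour_interconnect_iff, mem_behaviour_interconnect_iff]
  refine and_congr_left fun huA => ?_
  constructor
  · rintro ⟨hu, hy, heq⟩
    refine ⟨hu, hy, ?_⟩
    change matDiffOp G' y = matDiffOp (B * Γ.H) u
    rw [hB, matDiffOp_mul _ _ hy, matDiffOp_mul _ _ hu]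
    exact congrArg _ heq
  · rintro ⟨hu, hy, heq⟩
    obtain ⟨y₀, -, hy₀, heq₀⟩ := h huA
    refine ⟨hu, hy, ?_⟩
    change matDiffOp G' y = matDiffOp (B * Γ.H) u at heq
    change matDiffOp Γ.G y₀ = matDiffOp Γ.H u at heq₀
    change matDiffOp Γ.G y = matDiffOp Γ.H u
    calc matDiffOp Γ.G y = matDiffOp C (matDiffOp G' y) := by rw [← matDiffOp_mul _ _ hy, ← hC]
      _ = matDiffOp C (matDiffOp B (matDiffOp Γ.G y₀)) := by rw [heq, matDiffOp_mul _ _ hu, heq₀]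
      _ = matDiffOp Γ.G y₀ := by
        rw [← matDiffOp_mul _ _ hy₀, ← hB, ← matDiffOp_mul _ _ hy₀, ← hC]
      _ = matDiffOp Γ.H u := heq₀

end LTI

end

theorem mainTheorem2 (m p : ℕ) (A : LTI.InputSystem m) (Γ : LTI.System m p) :
    ((LTI.Contract.mk A Γ).Consistent → A.inputBehaviour ⊆ Γ.inputBehaviour) ∧
    (A.inputBehaviour ⊆ Γ.inputBehaviour →
      ∃ Γ' : LTI.System m p, LTI.FullRowRank Γ'.G ∧
        (LTI.interconnect A Γ).behaviour = (LTI.interconnect A Γ').behaviour) :=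
  ⟨LTI.Contract.Consistent.inputBehaviour_subset, LTI.exists_fullRowRank_interconnect_eq⟩
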